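/- Consider $N\ge 1$ sources sharing a slotted channel. If $s(t)$ is the set of sources that transmit in slot $t$, the age of information (AoI) of source $i$ evolves as $A_i(t+1)=1$ if $s(t)=\{i\}$ and $A_i(t+1)=A_i(t)+1$ otherwise, starting from arbitrary fixed positive integers $A_i(1)$. A scheduling policy chooses $s(t)$ causally, possibly at random, from the past. Under the idealized Fresh-CSMA policy with parameter $\alpha$, in each slot $t$ every source $i$ draws, independently given the past, an exponential timer $Z_i(t)$ with rate $\alpha^{w_iA_i(t)^2}$, and the source whose timer runs out first transmits. Let $w_1,\dots,w_N$ be positive integers and let $$\alpha>\frac{(N-1)\sum_{i=1}^N\sqrt{w_i}}{\min_j\sqrt{w_j}},\qquad \alpha>0.$$ Let $\bar A_i=\limsup_{T\to\infty}\frac1T\sum_{t=1}^T\mathbb E[A_i(t)]$ be the average AoI of source $i$, and let $\bar A_i^{csma}$, $\bar A_i^{opt}$ denote its values under Fresh-CSMA and under an optimal policy, i.e. one that minimizes $J(\pi)=\limsup_{T\to\infty}\frac1T\sum_{t=1}^T\mathbb E\big[\sum_{i=1}^N w_iA_i(t)\big]$ over all scheduling policies. Then $$\frac{\sum_{i=1}^N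 w_i\bar A_i^{csma}}{\sum_{i=1}^N w_i\bar A_i^{opt}}\le 2 .$$ Moreover $\sum_i w_i\bar A_i^{csma}\le 2\inf_\pi J(\pi)$, whether or not the infimum is attained. The bound also holds along sample paths: for every policy $\pi$, for almost every sample path of Fresh-CSMA and almost every sample path of $\pi$, the weighted sum $\sum_i w_i\limsup_T\frac1T\sum_{t\le T}A_i(t)$ along the former is at most twice $\limsup_T\frac1T\sum_{t\le T}\sum_i w_iA_i(t)$ along the latter. -/

import Mathlib

open MeasureTheory ProbabilityTheory Filter
open scoped ENNReal

namespace FreshCSMA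

/-- One slot of the age dynamics: `a` is the vector of current ages, `s` the set of sources that
transmit. Source `i` is delivered exactly when it is the only one that transmits. -/
def ageStep {N : ℕ} (a : Fin N → ℕ) (s : Finset (Fin N)) : Fin N → ℕ :=
  fun i => if s = {i} then 1 else a i + 1

/-- The age vector after `t` slots, from the initial ages `a₀` and the sets of sources that
transmitted in these slots. -/
def ageAfter {N : ℕ} (a₀ : Fin N → ℕ) : (t : ℕ) → (Fin t → Finset (Fin N)) → (Fin N → ℕ)
  | 0, _ => a₀
  | t + 1, h => ageStep (ageAfter a₀ t (Fin.init h)) (h (Fin.last t))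

/-- The age `A_i` at the beginning of slot `t` (slots are numbered `0, 1, 2, …`) along the whole
sequence `s` of transmitting sets. -/
def age {N : ℕ} (a₀ : Fin N → ℕ) (s : ℕ → Finset (Fin N)) (t : ℕ) (i : Fin N) : ℕ :=
  ageAfter a₀ t (fun k => s k) i

/-- A causal, possibly randomized, history-dependent scheduling policy: for each slot `t` and each
history of transmitting sets in the slots before `t`, the law of the set of sources that transmit
in slot `t` (idling and collisions are allowed). -/
structure Policy (N : ℕ) where
  decide : (t : ℕ) → (Fin t → Finset (Fin N)) → Measure (Finset (Fin N))
  isProb : ∀ t h, IsProbabilityMeasure (decide t h)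

/-- The decision rule of a policy in slot `n + 1`, as a Markov kernel. -/
noncomputable def Policy.kernel {N : ℕ} (π : Policy N) (n : ℕ) :
    Kernel ((k : Finset.Iic n) → (fun _ : ℕ => Finset (Fin N)) k) (Finset (Fin N)) where
  toFun h := π.decide (n + 1)
    (fun k => h ⟨k.1, Finset.mem_Iic.2 (Nat.le_of_lt_succ k.2)⟩)
  measurable' := measurable_of_countable _

instance Policy.instIsMarkovKernel {N : ℕ} (π : Policy N) (n : ℕ) :
    IsMarkovKernel (π.kernel n) :=
  ⟨fun _ => π.isProb _ _⟩

/-- The law, on sequences of transmitting sets, of the system run under the policy `π`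
(Ionescu-Tulcea). -/
noncomputable def Policy.law {N : ℕ} (π : Policy N) : Measure (ℕ → Finset (Fin N)) :=
  Kernel.trajMeasure (X := fun _ => Finset (Fin N)) (π.decide 0 Fin.elim0) π.kernel

/-- The sources whose backoff timer runs out first. -/
noncomputable def firstTimers {N : ℕ} (z : Fin N → ℝ) : Finset (Fin N) :=
  {i | ∀ j, z i ≤ z j}

theorem measurable_firstTimers {N : ℕ} : Measurable (firstTimers (N := N)) := by
  rw [measurable_finset_iff]
  intro i
  simp only [firstTimers, Finset.mem_filter, Finset.mem_univ, true_and]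
  refine Measurable.forall fun j => ?_
  exact measurableSet_setOfPred.1
    (measurableSet_le (measurable_pi_apply i) (measurable_pi_apply j))

/-- The joint law of the Fresh-CSMA backoff timers when the ages are `a`: they are independent, and
the timer of source `i` is exponential with rate `α ^ (w i * (a i) ^ 2)`. -/
noncomputable def timerLaw {N : ℕ} (w : Fin N → ℕ) (α : ℝ) (a : Fin N → ℕ) :
    Measure (Fin N → ℝ) :=
  Measure.pi fun i => expMeasure (α ^ (w i * a i ^ 2))

/-- Idealized Fresh-CSMA: in every slot fresh timers are drawn according to the current ages, and
whoever has the smallest timer transmits. -/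
noncomputable def freshCSMA {N : ℕ} (w : Fin N → ℕ) (α : ℝ) (hα : 0 < α) (a₀ : Fin N → ℕ) :
    Policy N where
  decide t h := (timerLaw w α (ageAfter a₀ t h)).map firstTimers
  isProb t h := by
    have : ∀ i, IsProbabilityMeasure (expMeasure (α ^ (w i * ageAfter a₀ t h i ^ 2))) :=
      fun i => isProbabilityMeasure_expMeasure (pow_pos hα _)
    unfold timerLaw
    exact Measure.isProbabilityMeasure_map measurable_firstTimers.aemeasurable

/-- The long-run time average `limsup_T (1 / T) ∑_{t < T} x t`. -/
noncomputable def timeAvg (x : ℕ → ℝ≥0∞) : ℝ≥0∞ :=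
  limsup (fun T : ℕ => (∑ t ∈ Finset.range T, x t) / (T : ℝ≥0∞)) atTop

/-- Average AoI of source `i` along the sequence `s` of transmitting sets. -/
noncomputable def pathAvgAoI {N : ℕ} (a₀ : Fin N → ℕ) (s : ℕ → Finset (Fin N)) (i : Fin N) :
    ℝ≥0∞ :=
  timeAvg fun t => (age a₀ s t i : ℝ≥0∞)

/-- The long-run average of the weighted sum of the ages along the sequence `s`. -/
noncomputable def pathCost {N : ℕ} (w : Fin N → ℕ) (a₀ : Fin N → ℕ) (s : ℕ → Finset (Fin N)) :
    ℝ≥0∞ :=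
  timeAvg fun t => ∑ i, (w i : ℝ≥0∞) * (age a₀ s t i : ℝ≥0∞)

/-- Average (expected) AoI of source `i` under the policy `π`. -/
noncomputable def avgAoI {N : ℕ} (a₀ : Fin N → ℕ) (π : Policy N) (i : Fin N) : ℝ≥0∞ :=
  timeAvg fun t => ∫⁻ s, (age a₀ s t i : ℝ≥0∞) ∂π.law

/-- The objective of the age minimization problem: the long-run average of the (expected) weighted
sum of the ages under the policy `π`. -/
noncomputable def cost {N : ℕ} (w : Fin N → ℕ) (a₀ : Fin N → ℕ) (π : Policy N) : ℝ≥0∞ :=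
  timeAvg fun t => ∫⁻ s, ∑ i, (w i : ℝ≥0∞) * (age a₀ s t i : ℝ≥0∞) ∂π.law

/-- `π` solves the age minimization problem. -/
def IsOptimal {N : ℕ} (w : Fin N → ℕ) (a₀ : Fin N → ℕ) (π : Policy N) : Prop :=
  ∀ π' : Policy N, cost w a₀ π ≤ cost w a₀ π'

end FreshCSMA

/-!
The two sides of the comparison are separated by the number `(S ^ 2 + W) / 2`, where `S = ∑ √wᵢ` and
`W = ∑ wᵢ`: every policy has cost at least this much, and Fresh-CSMA has weighted average age at
most `S ^ 2 + 1 ≤ S ^ 2 + W`. Both bounds hold in mean and along sample paths.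

*Lower bound.* If source `i` is delivered a fraction `λᵢ` of the time, convexity makes its average
age at least `(1 / λᵢ + 1) / 2`, and `∑ λᵢ ≤ 1` gives `∑ wᵢ / λᵢ ≥ S ^ 2`. In linearized form
(`sum_age_ge_tangent`, at the optimal interval `x = S / √wᵢ`) this is a deterministic inequality for
every finite horizon and every sequence of transmitting sets (`exists_sum_age_lower_bound`), so no
probability enters.

*Upper bound.* Serving the source with the largest `wᵢ aᵢ²` is serving the one with the largest
`√wᵢ aᵢ`, the peak. The linear Lyapunov function `∑ √wᵢ aᵢ` increases in a slot by `S` minus the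
`√wᵢ aᵢ` of the delivered source. Hence under exact service of the peak the average peak would be at
most `S`, and since `√wᵢ aᵢ` is at most the peak for all `i`, the weighted average age would be at
most `S ^ 2`. Fresh-CSMA falls short of the peak in a slot with small probability: since the indices
`wᵢ aᵢ²` are integers, a source whose index is smaller by `d` wins with probability at most
`α ^ (-d)` (`timerLaw_le`), while the shortfall is at most `d / (2 min √w)`. So the shortfall has an
exponential moment close to `1` (`lintegral_exp_shortfall_le`), and the condition on `α` makes the
loss per slot less than `1 / S` (`loss_lt`), which adds less than `1` to the weighted average age.
Multiplying the one-slot estimates gives an exponential moment bound for the accumulated peaks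
(`lintegral_exp_cumulative_le`). Jensen's inequality extracts the bound in mean from it, and
Borel–Cantelli the almost sure one.
-/

namespace FreshCSMA

theorem age_succ {N : ℕ} (a₀ : Fin N → ℕ) (s : ℕ → Finset (Fin N)) (t : ℕ) :
    age a₀ s (t + 1) = ageStep (age a₀ s t) (s t) := rfl

theorem one_le_ageAfter {N : ℕ} {a₀ : Fin N → ℕ} (ha₀ : ∀ i, 1 ≤ a₀ i) (t : ℕ)
    (h : Fin t → Finset (Fin N)) (i : Fin N) : 1 ≤ ageAfter a₀ t h i := by
  cases t with
  | zero => exact ha₀ i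
  | succ t =>
    simp only [ageAfter, ageStep]
    split_ifs <;> omega

/-! ### Time averages -/

theorem limsup_add_le_add_limsup {u v : ℕ → ℝ≥0∞} :
    limsup (u + v) atTop ≤ limsup u atTop + limsup v atTop := by
  refine ENNReal.le_of_forall_pos_le_add fun ε hε hlt => ?_
  obtain ⟨hu, hv⟩ := ENNReal.add_lt_top.1 hlt
  have hε2 : (ε / 2 : ℝ≥0∞) ≠ 0 := by simpa using hε.ne'
  refine limsup_le_of_le (by isBoundedDefault) ?_
  filter_upwards [eventually_lt_of_limsup_lt (ENNReal.lt_add_right hu.ne hε2),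
    eventually_lt_of_limsup_lt (ENNReal.lt_add_right hv.ne hε2)] with n h1 h2
  calc u n + v n ≤ (limsup u atTop + ε / 2) + (limsup v atTop + ε / 2) :=
        add_le_add h1.le h2.le
    _ = limsup u atTop + limsup v atTop + ε := by
        rw [add_add_add_comm, ENNReal.add_halves]

theorem limsup_const_div_natCast {C : ℝ≥0∞} (hC : C ≠ ∞) :
    limsup (fun T : ℕ => C / (T : ℝ≥0∞)) atTop = 0 := by
  have := ENNReal.Tendsto.const_div ENNReal.tendsto_nat_nhds_top (Or.inr hC)
  rw [ENNReal.div_top] at this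
  exact this.limsup_eq

theorem le_timeAvg {x : ℕ → ℝ≥0∞} {L C : ℝ≥0∞} (hC : C ≠ ∞)
    (h : ∀ T : ℕ, L * T ≤ (∑ t ∈ Finset.range T, x t) + C) : L ≤ timeAvg x := by
  calc L = limsup (fun _ : ℕ => L) atTop := by simp
    _ ≤ limsup ((fun T : ℕ => (∑ t ∈ Finset.range T, x t) / (T : ℝ≥0∞)) +
          fun T : ℕ => C / (T : ℝ≥0∞)) atTop := by
        refine limsup_le_limsup ?_
        filter_upwards [eventually_gt_atTop 0] with T hT
        have hT0 : (T : ℝ≥0∞) ≠ 0 := by exact_mod_cast hT.ne'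
        rw [Pi.add_apply, ← ENNReal.add_div, ENNReal.le_div_iff_mul_le (Or.inl hT0) (by simp)]
        exact h T
    _ ≤ _ := limsup_add_le_add_limsup
    _ = timeAvg x := by rw [limsup_const_div_natCast hC, add_zero, timeAvg]

theorem timeAvg_le {x : ℕ → ℝ≥0∞} {U C : ℝ≥0∞} (hC : C ≠ ∞)
    (h : ∀ᶠ T : ℕ in atTop, ∑ t ∈ Finset.range T, x t ≤ U * T + C) : timeAvg x ≤ U := by
  calc timeAvg x ≤ limsup ((fun _ : ℕ => U) + fun T : ℕ => C / (T : ℝ≥0∞)) atTop := by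
        refine limsup_le_limsup ?_
        filter_upwards [h, eventually_gt_atTop 0] with T h hT
        have hT0 : (T : ℝ≥0∞) ≠ 0 := by exact_mod_cast hT.ne'
        rw [Pi.add_apply, ENNReal.div_le_iff hT0 (by simp), add_mul,
          ENNReal.div_mul_cancel hT0 (by simp)]
        exact h
    _ ≤ _ := limsup_add_le_add_limsup
    _ = U := by rw [limsup_const_div_natCast hC, add_zero]; simp

theorem timeAvg_sum_le {ι : Type*} (s : Finset ι) (c : ι → ℝ≥0∞) (hc : ∀ i, c i ≠ ∞)
    (x : ι → ℕ → ℝ≥0∞) :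
    timeAvg (fun t => ∑ i ∈ s, c i * x i t) ≤ ∑ i ∈ s, c i * timeAvg (x i) := by
  classical
  induction s using Finset.induction_on with
  | empty => simp [timeAvg]
  | insert i s hi ih =>
    rw [Finset.sum_insert hi]
    refine le_trans ?_ (add_le_add le_rfl ih)
    have : c i * timeAvg (x i) = timeAvg fun t => c i * x i t := by
      simp only [timeAvg]
      rw [← ENNReal.limsup_const_mul_of_ne_top (hc i)]
      simp only [← mul_div_assoc, ← Finset.mul_sum]
    rw [this]
    refine le_trans (le_of_eq ?_) limsup_add_le_add_limsup
    simp only [timeAvg, Finset.sum_insert hi]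
    congr 1
    funext T
    rw [Pi.add_apply, Finset.sum_add_distrib, ENNReal.add_div]

/-! ### The universal lower bound -/

/-- Lower bound for the accumulated age of one source, with `x` standing for a target time between
deliveries and a price `x ^ 2` per delivery. It is the tangent-line form, in `x`, of the convexity
bound for the sum of `I (I + 1) / 2` over the delivery intervals `I`. The square on the left is the
state-dependent term that closes the induction: a delivery at age `a` costs `(a - x) ^ 2 ≥ 0`. -/
theorem sum_age_ge_tangent {N : ℕ} (a₀ : Fin N → ℕ) (s : ℕ → Finset (Fin N)) (i : Fin N) (x : ℝ)
    (T : ℕ) :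
    ((age a₀ s T i : ℝ) - 1 - x) ^ 2 + T * (1 + 2 * x) ≤
      2 * (∑ t ∈ Finset.range T, (age a₀ s t i : ℝ)) +
        x ^ 2 * (∑ t ∈ Finset.range T, if s t = {i} then 1 else 0) +
        (x ^ 2 + ((a₀ i : ℝ) - 1 - x) ^ 2) := by
  induction T with
  | zero => simp [age, ageAfter]; positivity
  | succ T ih =>
    have hpos : 0 ≤ ((age a₀ s T i : ℝ) - 1 - x) ^ 2 := sq_nonneg _
    rw [Finset.sum_range_succ, Finset.sum_range_succ, age_succ]
    simp only [ageStep]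
    push_cast
    split_ifs with h
    · linear_combination ih + sq_nonneg ((age a₀ s T i : ℝ) - x)
    · linear_combination ih

/-- Along every sequence of transmitting sets, and not merely on average, the accumulated weighted
age is at least `T * ((∑ √wᵢ)² + ∑ wᵢ) / 2` up to a constant. -/
theorem exists_sum_age_lower_bound {N : ℕ} (w : Fin N → ℕ) (hw : ∀ i, 0 < w i) (a₀ : Fin N → ℕ) :
    ∃ C : ℝ, 0 ≤ C ∧ ∀ (s : ℕ → Finset (Fin N)) (T : ℕ),
      ((∑ i, √(w i : ℝ)) ^ 2 + ∑ i, (w i : ℝ)) / 2 * T ≤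
        (∑ t ∈ Finset.range T, ∑ i, (w i : ℝ) * (age a₀ s t i : ℝ)) + C := by
  set S := ∑ i, √(w i : ℝ) with hS
  have hsq : ∀ i, 0 < √(w i : ℝ) := fun i => Real.sqrt_pos.2 (by exact_mod_cast hw i)
  -- the optimal inter-delivery time of source `i` is `S / √wᵢ`
  let x : Fin N → ℝ := fun i => S / √(w i : ℝ)
  let c : Fin N → ℝ := fun i => x i ^ 2 + ((a₀ i : ℝ) - 1 - x i) ^ 2
  have hwx : ∀ i, (w i : ℝ) * x i = √(w i : ℝ) * S := fun i => by
    have := (hsq i).ne'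
    simp only [x]
    nth_rw 1 [← Real.mul_self_sqrt (Nat.cast_nonneg (w i))]
    field_simp
  have hwx2 : ∀ i, (w i : ℝ) * x i ^ 2 = S ^ 2 := fun i => by
    have := (hsq i).ne'
    simp only [x]
    nth_rw 1 [← Real.mul_self_sqrt (Nat.cast_nonneg (w i))]
    field_simp
  refine ⟨∑ i, (w i : ℝ) * c i, Finset.sum_nonneg fun i _ => by positivity, fun s T => ?_⟩
  -- at most one source is delivered in each slot
  have hdel : ∑ i : Fin N, ∑ t ∈ Finset.range T, (if s t = {i} then (1 : ℝ) else 0) ≤ T := by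
    rw [Finset.sum_comm]
    calc _ ≤ ∑ t ∈ Finset.range T, (1 : ℝ) := Finset.sum_le_sum fun t _ => by
          by_cases h : ∃ i, s t = {i}
          · obtain ⟨i, hi⟩ := h
            simp [hi, Finset.singleton_inj]
          · push Not at h
            simp [h]
      _ = T := by simp
  have key : ∀ i, (w i : ℝ) * (T * (1 + 2 * x i)) ≤
      2 * (∑ t ∈ Finset.range T, (w i : ℝ) * (age a₀ s t i : ℝ)) +
        S ^ 2 * (∑ t ∈ Finset.range T, if s t = {i} then (1 : ℝ) else 0) + w i * c i := fun i => by
    have h := sum_age_ge_tangent a₀ s i (x i) T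
    have h2 : (T : ℝ) * (1 + 2 * x i) ≤
      2 * (∑ t ∈ Finset.range T, (age a₀ s t i : ℝ)) +
        x i ^ 2 * (∑ t ∈ Finset.range T, if s t = {i} then (1 : ℝ) else 0) + c i := by
      linarith [sq_nonneg ((age a₀ s T i : ℝ) - 1 - x i)]
    have h3 := mul_le_mul_of_nonneg_left h2 (Nat.cast_nonneg (α := ℝ) (w i))
    rw [← Finset.mul_sum, ← hwx2 i]
    linarith
  have hsum := Finset.sum_le_sum fun i (_ : i ∈ Finset.univ) => key i
  have hl : ∑ i, (w i : ℝ) * (T * (1 + 2 * x i)) = T * ∑ i, (w i : ℝ) + 2 * T * S ^ 2 := by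
    have : ∀ i, (w i : ℝ) * (T * (1 + 2 * x i)) = T * w i + 2 * T * S * √(w i : ℝ) := fun i => by
      linear_combination 2 * (T : ℝ) * hwx i
    rw [Finset.sum_congr rfl fun i _ => this i, Finset.sum_add_distrib, ← Finset.mul_sum,
      ← Finset.mul_sum, ← hS]
    ring
  rw [hl, Finset.sum_add_distrib, Finset.sum_add_distrib, ← Finset.mul_sum, ← Finset.mul_sum,
    Finset.sum_comm] at hsum
  have hc : 0 ≤ ∑ i, (w i : ℝ) * c i := Finset.sum_nonneg fun i _ => by positivity
  nlinarith [mul_le_mul_of_nonneg_left hdel (sq_nonneg S)]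

theorem ofReal_sum_weighted_age {N : ℕ} (w a : Fin N → ℕ) :
    ENNReal.ofReal (∑ i, (w i : ℝ) * (a i : ℝ)) = ∑ i, (w i : ℝ≥0∞) * (a i : ℝ≥0∞) := by
  rw [ENNReal.ofReal_sum_of_nonneg fun i _ => by positivity]
  refine Finset.sum_congr rfl fun i _ => ?_
  rw [ENNReal.ofReal_mul (Nat.cast_nonneg _), ENNReal.ofReal_natCast, ENNReal.ofReal_natCast]

theorem exists_sum_age_lower_bound_ennreal {N : ℕ} (w : Fin N → ℕ) (hw : ∀ i, 0 < w i)
    (a₀ : Fin N → ℕ) :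
    ∃ C : ℝ≥0∞, C ≠ ∞ ∧ ∀ (s : ℕ → Finset (Fin N)) (T : ℕ),
      ENNReal.ofReal (((∑ i, √(w i : ℝ)) ^ 2 + ∑ i, (w i : ℝ)) / 2) * T ≤
        (∑ t ∈ Finset.range T, ∑ i, (w i : ℝ≥0∞) * (age a₀ s t i : ℝ≥0∞)) + C := by
  obtain ⟨C, hC, h⟩ := exists_sum_age_lower_bound w hw a₀
  refine ⟨ENNReal.ofReal C, ENNReal.ofReal_ne_top, fun s T => ?_⟩
  have hnn : ∀ t, 0 ≤ ∑ i, (w i : ℝ) * (age a₀ s t i : ℝ) := fun t =>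
    Finset.sum_nonneg fun i _ => by positivity
  calc _ = ENNReal.ofReal (((∑ i, √(w i : ℝ)) ^ 2 + ∑ i, (w i : ℝ)) / 2 * T) := by
        rw [ENNReal.ofReal_mul (by positivity), ENNReal.ofReal_natCast]
    _ ≤ _ := ENNReal.ofReal_le_ofReal (h s T)
    _ = _ := by
        rw [ENNReal.ofReal_add (Finset.sum_nonneg fun t _ => hnn t) hC,
          ENNReal.ofReal_sum_of_nonneg fun t _ => hnn t]
        simp only [ofReal_sum_weighted_age]

/-- The universal lower bound holds on every path, without an exceptional null set. -/
theorem le_pathCost {N : ℕ} (w : Fin N → ℕ) (hw : ∀ i, 0 < w i) (a₀ : Fin N → ℕ)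
    (s : ℕ → Finset (Fin N)) :
    ENNReal.ofReal (((∑ i, √(w i : ℝ)) ^ 2 + ∑ i, (w i : ℝ)) / 2) ≤ pathCost w a₀ s := by
  obtain ⟨C, hC, h⟩ := exists_sum_age_lower_bound_ennreal w hw a₀
  exact le_timeAvg hC (h s)

theorem measurable_age {N : ℕ} (a₀ : Fin N → ℕ) (t : ℕ) (i : Fin N) :
    Measurable fun s : ℕ → Finset (Fin N) => age a₀ s t i :=
  (measurable_of_countable fun h : Fin t → Finset (Fin N) => ageAfter a₀ t h i).comp
    (measurable_pi_lambda _ fun _ => measurable_pi_apply _)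

instance Policy.instIsProbabilityMeasureLaw {N : ℕ} (π : Policy N) :
    IsProbabilityMeasure π.law := by
  have := π.isProb 0 Fin.elim0
  unfold Policy.law
  infer_instance

theorem le_cost {N : ℕ} (w : Fin N → ℕ) (hw : ∀ i, 0 < w i) (a₀ : Fin N → ℕ) (π : Policy N) :
    ENNReal.ofReal (((∑ i, √(w i : ℝ)) ^ 2 + ∑ i, (w i : ℝ)) / 2) ≤ cost w a₀ π := by
  obtain ⟨C, hC, h⟩ := exists_sum_age_lower_bound_ennreal w hw a₀
  refine le_timeAvg hC fun T => ?_
  have hm : ∀ t, Measurable fun s : ℕ → Finset (Fin N) =>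
      ∑ i, (w i : ℝ≥0∞) * (age a₀ s t i : ℝ≥0∞) := fun t =>
    Finset.measurable_sum _ fun i _ =>
      ((measurable_of_countable _).comp (measurable_age a₀ t i)).const_mul _
  rw [← lintegral_finsetSum _ fun t _ => hm t]
  calc _ = ∫⁻ _, ENNReal.ofReal (((∑ i, √(w i : ℝ)) ^ 2 + ∑ i, (w i : ℝ)) / 2) * T ∂π.law := by
        simp
    _ ≤ ∫⁻ s, (∑ t ∈ Finset.range T, ∑ i, (w i : ℝ≥0∞) * (age a₀ s t i : ℝ≥0∞)) + C ∂π.law :=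
        lintegral_mono fun s => h s T
    _ = _ := by rw [lintegral_add_right _ measurable_const]; simp

theorem cost_le_sum_avgAoI {N : ℕ} (w : Fin N → ℕ) (a₀ : Fin N → ℕ) (π : Policy N) :
    cost w a₀ π ≤ ∑ i, (w i : ℝ≥0∞) * avgAoI a₀ π i := by
  have hm : ∀ t i, Measurable fun s : ℕ → Finset (Fin N) => (age a₀ s t i : ℝ≥0∞) := fun t i =>
    (measurable_of_countable _).comp (measurable_age a₀ t i)
  refine le_trans (le_of_eq ?_)
    (timeAvg_sum_le Finset.univ (fun i => (w i : ℝ≥0∞)) (fun i => ENNReal.natCast_ne_top _)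
      fun i t => ∫⁻ s, (age a₀ s t i : ℝ≥0∞) ∂π.law)
  unfold cost
  congr 1
  funext t
  rw [lintegral_finsetSum _ fun i _ => (hm t i).const_mul _]
  exact Finset.sum_congr rfl fun i _ => lintegral_const_mul _ (hm t i)

/-! ### The law of the next slot given the past -/

/-- Under the law of a policy, the set that transmits in slot `t` is distributed, given the earlier
slots, according to the decision rule. -/
theorem lintegral_law_eq {N : ℕ} (π : Policy N) (t : ℕ)
    (f : (Fin t → Finset (Fin N)) → Finset (Fin N) → ℝ≥0∞) :
    ∫⁻ s, f (fun k => s k) (s t) ∂π.law =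
      ∫⁻ s, ∫⁻ u, f (fun k => s k) u ∂π.decide t (fun k => s k) ∂π.law := by
  have := π.isProb 0 Fin.elim0
  cases t with
  | zero =>
    have key : π.law.map (fun s => s 0) = π.decide 0 Fin.elim0 := by
      have h1 : π.law.map (Preorder.frestrictLe 0) =
          (π.decide 0 Fin.elim0).map
            (MeasurableEquiv.piUnique fun _ : Finset.Iic 0 => Finset (Fin N)).symm := by
        rw [Policy.law, Kernel.trajMeasure, Measure.map_comp _ _ (by fun_prop),
          Kernel.traj_map_frestrictLe, Kernel.partialTraj_self, Measure.id_comp]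
      have h2 := congrArg (Measure.map fun h : (k : Finset.Iic 0) → Finset (Fin N) =>
        h ⟨0, Finset.mem_Iic.2 le_rfl⟩) h1
      rw [Measure.map_map (by fun_prop) (by fun_prop),
        Measure.map_map (by fun_prop) (by fun_prop)] at h2
      refine h2.trans ?_
      convert Measure.map_id
      funext x
      exact (MeasurableEquiv.piUnique fun _ : Finset.Iic 0 => Finset (Fin N)).apply_symm_apply x
    have h0 : ∀ s : ℕ → Finset (Fin N), (fun k : Fin 0 => s k) = Fin.elim0 := fun s =>
      Subsingleton.elim _ _
    simp only [h0, lintegral_const, measure_univ, mul_one, ← key]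
    rw [lintegral_map (measurable_of_countable _) (by fun_prop)]
  | succ n =>
    let r : ((k : Finset.Iic n) → (fun _ : ℕ => Finset (Fin N)) k) →
        (Fin (n + 1) → Finset (Fin N)) :=
      fun h k => h ⟨k.1, Finset.mem_Iic.2 (Nat.le_of_lt_succ k.2)⟩
    have key := Kernel.map_frestrictLe_trajMeasure_compProd_eq_map_trajMeasure
      (X := fun _ => Finset (Fin N)) (μ₀ := π.decide 0 Fin.elim0) (κ := π.kernel) (a := n)
    have h2 := congrArg (fun μ => ∫⁻ p, f (r p.1) p.2 ∂μ) key
    rw [Measure.lintegral_compProd (measurable_of_countable _),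
      lintegral_map (measurable_of_countable _) (by fun_prop),
      lintegral_map (measurable_of_countable _) (by fun_prop)] at h2
    exact h2.symm

/-! ### Exponential timers -/

theorem expMeasure_singleton (r x : ℝ) : expMeasure r {x} = 0 :=
  withDensity_absolutelyContinuous _ _ (by simp)

theorem expMeasure_Ici {r : ℝ} (hr : 0 < r) {x : ℝ} (hx : 0 ≤ x) :
    expMeasure r (Set.Ici x) = ENNReal.ofReal (Real.exp (-(r * x))) := by
  have := isProbabilityMeasure_expMeasure hr
  have hle : expMeasure r (Set.Iic x) = ENNReal.ofReal (1 - Real.exp (-(r * x))) := by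
    rw [← ofReal_cdf, cdf_expMeasure_eq hr, if_pos hx]
  have hlt : expMeasure r (Set.Iio x) = expMeasure r (Set.Iic x) := by
    refine le_antisymm (measure_mono Set.Iio_subset_Iic_self) ?_
    rw [← Set.Iio_union_right]
    exact (measure_union_le _ _).trans (by rw [expMeasure_singleton, add_zero])
  have h1 : Real.exp (-(r * x)) ≤ 1 := Real.exp_le_one_iff.2 (by nlinarith)
  rw [← Set.compl_Iio, prob_compl_eq_one_sub measurableSet_Iio, hlt, hle,
    ← ENNReal.ofReal_one, ← ENNReal.ofReal_sub _ (by linarith)]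
  congr 1
  ring

/-- A clock of rate `r₁` beats a clock of rate `r₂` with probability at most `r₁ / r₂`; the exact
value `r₁ / (r₁ + r₂)` is not needed. -/
theorem expMeasure_prod_le {r₁ r₂ : ℝ} (h₁ : 0 < r₁) (h₂ : 0 < r₂) :
    ((expMeasure r₁).prod (expMeasure r₂)) {p | p.1 ≤ p.2} ≤ ENNReal.ofReal (r₁ / r₂) := by
  have := isProbabilityMeasure_expMeasure h₁
  have := isProbabilityMeasure_expMeasure h₂
  rw [Measure.prod_apply (measurableSet_le measurable_fst measurable_snd)]
  have hset : ∀ x : ℝ, Prod.mk x ⁻¹' {p : ℝ × ℝ | p.1 ≤ p.2} = Set.Ici x := fun x => rfl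
  simp only [hset]
  have hmeas : Measurable fun x => expMeasure r₂ (Set.Ici x) := by
    have := measurable_measure_prodMk_left (ν := expMeasure r₂)
      (measurableSet_le (measurable_fst (α := ℝ) (β := ℝ)) measurable_snd)
    simpa only [hset] using this
  have hpdf : ∀ r, expMeasure r = volume.withDensity (exponentialPDF r) := fun r => rfl
  have hpm : ∀ r, Measurable (exponentialPDF r) := fun r =>
    (measurable_exponentialPDFReal r).ennreal_ofReal
  rw [hpdf r₁, lintegral_withDensity_eq_lintegral_mul _ (hpm r₁) hmeas]
  calc _ ≤ ∫⁻ x, ENNReal.ofReal (r₁ / r₂) * exponentialPDF r₂ x := by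
        refine lintegral_mono fun x => ?_
        simp only [Pi.mul_apply]
        rcases lt_or_ge x 0 with hx | hx
        · simp [exponentialPDF_of_neg hx]
        · rw [expMeasure_Ici h₂ hx, exponentialPDF_of_nonneg hx, exponentialPDF_of_nonneg hx,
            ← ENNReal.ofReal_mul (by positivity), ← ENNReal.ofReal_mul (by positivity)]
          refine ENNReal.ofReal_le_ofReal ?_
          have h1 : Real.exp (-(r₁ * x)) ≤ 1 := Real.exp_le_one_iff.2 (by nlinarith)
          have h3 : r₁ / r₂ * (r₂ * Real.exp (-(r₂ * x))) = r₁ * Real.exp (-(r₂ * x)) := by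
            field_simp
          rw [h3]
          have := mul_le_mul_of_nonneg_left h1 (by positivity : 0 ≤ r₁ * Real.exp (-(r₂ * x)))
          linarith
    _ = ENNReal.ofReal (r₁ / r₂) := by
        rw [lintegral_const_mul _ (hpm r₂), lintegral_exponentialPDF_eq_one h₂, mul_one]

theorem expMeasure_prod_diagonal {r₁ r₂ : ℝ} (h₂ : 0 < r₂) :
    ((expMeasure r₁).prod (expMeasure r₂)) {p | p.1 = p.2} = 0 := by
  have := isProbabilityMeasure_expMeasure h₂
  rw [Measure.prod_apply (measurableSet_eq_fun measurable_fst measurable_snd)]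
  have hset : ∀ x : ℝ, Prod.mk x ⁻¹' {p : ℝ × ℝ | p.1 = p.2} = {x} := fun x => by
    ext y; simp [eq_comm]
  simp [hset, expMeasure_singleton]

theorem map_pair_pi_expMeasure {N : ℕ} {r : Fin N → ℝ} (hr : ∀ i, 0 < r i) {i j : Fin N}
    (hij : i ≠ j) :
    (Measure.pi fun k => expMeasure (r k)).map (fun z => (z i, z j)) =
      (expMeasure (r i)).prod (expMeasure (r j)) := by
  have : ∀ k, IsProbabilityMeasure (expMeasure (r k)) := fun k =>
    isProbabilityMeasure_expMeasure (hr k)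
  have hind : IndepFun (fun z : Fin N → ℝ => z i) (fun z => z j)
      (Measure.pi fun k => expMeasure (r k)) :=
    (iIndepFun_pi (μ := fun k => expMeasure (r k)) (X := fun _ => id)
      fun _ => aemeasurable_id).indepFun hij
  rw [indepFun_iff_map_prod_eq_prod_map_map (measurable_pi_apply i).aemeasurable
    (measurable_pi_apply j).aemeasurable] at hind
  rw [hind]
  congr 1
  · exact (measurePreserving_eval (fun k => expMeasure (r k)) i).map_eq
  · exact (measurePreserving_eval (fun k => expMeasure (r k)) j).map_eq

theorem isProbabilityMeasure_timerLaw {N : ℕ} (w : Fin N → ℕ) {α : ℝ} (hα : 0 < α)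
    (a : Fin N → ℕ) : IsProbabilityMeasure (timerLaw w α a) := by
  have : ∀ i, IsProbabilityMeasure (expMeasure (α ^ (w i * a i ^ 2))) :=
    fun i => isProbabilityMeasure_expMeasure (pow_pos hα _)
  unfold timerLaw
  infer_instance

theorem timerLaw_le {N : ℕ} (w : Fin N → ℕ) {α : ℝ} (hα : 0 < α) (a : Fin N → ℕ) {i j : Fin N}
    (hij : i ≠ j) :
    timerLaw w α a {z | z i ≤ z j} ≤
      ENNReal.ofReal (α ^ (w i * a i ^ 2) / α ^ (w j * a j ^ 2)) := by
  refine le_trans (le_of_eq ?_) (expMeasure_prod_le (pow_pos hα _) (pow_pos hα _))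
  rw [← map_pair_pi_expMeasure (r := fun k => α ^ (w k * a k ^ 2)) (fun k => pow_pos hα _) hij,
    Measure.map_apply (by fun_prop) (measurableSet_le measurable_fst measurable_snd)]
  rfl

/-- Ties between exponential timers are negligible, so Fresh-CSMA delivers in every slot. -/
theorem ae_firstTimers_eq_singleton {N : ℕ} (hN : 1 ≤ N) (w : Fin N → ℕ) {α : ℝ} (hα : 0 < α)
    (a : Fin N → ℕ) : ∀ᵐ z ∂timerLaw w α a, ∃ i, firstTimers z = {i} := by
  have hne : ∀ᵐ z ∂timerLaw w α a, ∀ i j, i ≠ j → z i ≠ z j := by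
    refine ae_all_iff.2 fun i => ae_all_iff.2 fun j => ?_
    by_cases hij : i = j
    · simp [hij]
    · have h0 := expMeasure_prod_diagonal (r₁ := α ^ (w i * a i ^ 2)) (pow_pos hα (w j * a j ^ 2))
      rw [← map_pair_pi_expMeasure (r := fun k => α ^ (w k * a k ^ 2)) (fun k => pow_pos hα _) hij,
        Measure.map_apply (by fun_prop) (measurableSet_eq_fun measurable_fst measurable_snd)] at h0
      have h1 : ∀ᵐ z ∂timerLaw w α a, ¬ z i = z j := measure_eq_zero_iff_ae_notMem.1 h0
      filter_upwards [h1] with z hz _ using hz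
  have : Nonempty (Fin N) := ⟨⟨0, hN⟩⟩
  filter_upwards [hne] with z hz
  obtain ⟨i, hi⟩ := Finite.exists_min z
  refine ⟨i, ?_⟩
  ext j
  simp only [firstTimers, Finset.mem_filter, Finset.mem_univ, true_and, Finset.mem_singleton]
  constructor
  · intro hj
    by_contra hne'
    exact hz j i hne' (le_antisymm (hj i) (hi j))
  · rintro rfl
    exact hi

/-! ### One slot of Fresh-CSMA -/

/-- The linear Lyapunov function `∑ √wᵢ aᵢ` of the age vector. -/
noncomputable def potential {N : ℕ} (w a : Fin N → ℕ) : ℝ := ∑ i, √(w i : ℝ) * a i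

/-- The largest value of `√wᵢ aᵢ`. -/
noncomputable def peak {N : ℕ} (w a : Fin N → ℕ) : ℝ := ⨆ i, √(w i : ℝ) * a i

/-- The value `√wᵢ aᵢ` of the delivered source `i`, and `0` in a slot without delivery. -/
noncomputable def gain {N : ℕ} (w a : Fin N → ℕ) (u : Finset (Fin N)) : ℝ :=
  ∑ i, if u = {i} then √(w i : ℝ) * a i else 0

theorem gain_singleton {N : ℕ} (w a : Fin N → ℕ) (i : Fin N) :
    gain w a {i} = √(w i : ℝ) * a i := by
  simp [gain, Finset.singleton_inj]

theorem le_peak {N : ℕ} (w a : Fin N → ℕ) (i : Fin N) : √(w i : ℝ) * a i ≤ peak w a :=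
  le_ciSup (Finite.bddAbove_range fun i => √(w i : ℝ) * a i) i

theorem potential_nonneg {N : ℕ} (w a : Fin N → ℕ) : 0 ≤ potential w a :=
  Finset.sum_nonneg fun _ _ => by positivity

/-- The increment of the potential does not depend on the ages except through the gain. -/
theorem potential_ageStep {N : ℕ} (w a : Fin N → ℕ) (u : Finset (Fin N)) :
    potential w (ageStep a u) = potential w a + ∑ i, √(w i : ℝ) - gain w a u := by
  simp only [potential, gain, ← Finset.sum_add_distrib, ← Finset.sum_sub_distrib, ageStep]
  refine Finset.sum_congr rfl fun i _ => ?_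
  split_ifs
  · push_cast; ring
  · push_cast; ring

/-- The smallest root weight `min √wⱼ`. -/
noncomputable def minRoot {N : ℕ} (w : Fin N → ℕ) : ℝ := ⨅ j, √(w j : ℝ)

theorem minRoot_le {N : ℕ} (w : Fin N → ℕ) (i : Fin N) : minRoot w ≤ √(w i : ℝ) :=
  ciInf_le (Finite.bddBelow_range fun i => √(w i : ℝ)) i

theorem minRoot_pos {N : ℕ} (hN : 1 ≤ N) {w : Fin N → ℕ} (hw : ∀ i, 0 < w i) : 0 < minRoot w := by
  have : Nonempty (Fin N) := ⟨⟨0, hN⟩⟩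
  obtain ⟨i, hi⟩ := exists_eq_ciInf_of_finite (f := fun i => √(w i : ℝ))
  rw [minRoot, ← hi]
  exact Real.sqrt_pos.2 (by exact_mod_cast hw i)

/-- The exponent at which exponential moments are taken. The shortfall `√wⱼ aⱼ - √wᵢ aᵢ` is at most
`d / (2 min √w)`, where `d` is the integer `wⱼ aⱼ² - wᵢ aᵢ²`, so this choice bounds the exponential
of the shortfall by `(3 / 2) ^ d`, which the winning probability `α ^ (-d)` outweighs for `α ≥ 2`. -/
noncomputable def rate {N : ℕ} (w : Fin N → ℕ) : ℝ := 2 * minRoot w * Real.log (3 / 2)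

theorem rate_pos {N : ℕ} (hN : 1 ≤ N) {w : Fin N → ℕ} (hw : ∀ i, 0 < w i) : 0 < rate w :=
  mul_pos (mul_pos two_pos (minRoot_pos hN hw)) (Real.log_pos (by norm_num))

/-- Equality holds at `k = 1`, so that `5 / 8` is the best constant for the base `3 / 2`. -/
theorem three_halves_pow_le (k : ℕ) : (3 / 2 : ℝ) ^ (k + 1) ≤ 1 + 5 / 8 * 2 ^ k := by
  match k with
  | 0 => norm_num
  | 1 => norm_num
  | k + 2 =>
    have ih := three_halves_pow_le (k + 1)
    have h2 : (1 : ℝ) ≤ 2 ^ k := one_le_pow₀ (by norm_num)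
    have e1 : (3 / 2 : ℝ) ^ (k + 2 + 1) = (3 / 2) ^ (k + 1 + 1) * (3 / 2) := pow_succ _ _
    have e2 : (2 : ℝ) ^ (k + 1) = 2 * 2 ^ k := by ring
    have e3 : (2 : ℝ) ^ (k + 2) = 4 * 2 ^ k := by ring
    rw [e2] at ih
    rw [e1, e3]
    linarith

/-- If `α ≥ 2`, a source whose index `w a ^ 2` is below the maximal one wins the slot with so small
a probability that its contribution to the exponential moment of the shortfall is `O(1 / α)`. -/
theorem exp_shortfall_mul_le {N : ℕ} {w : Fin N → ℕ} {α : ℝ}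
    (hα : 2 ≤ α) {a : Fin N → ℕ} (ha : ∀ i, 1 ≤ a i) {i j : Fin N}
    (hij : √(w i : ℝ) * a i ≤ √(w j : ℝ) * a j) :
    (Real.exp (rate w * (√(w j : ℝ) * a j - √(w i : ℝ) * a i)) - 1) *
      (α ^ (w i * a i ^ 2) / α ^ (w j * a j ^ 2)) ≤ 5 / 8 / α := by
  set D := √(w j : ℝ) * a j - √(w i : ℝ) * a i with hD
  have hα0 : 0 < α := by linarith
  have hsq : ∀ k, ((w k * a k ^ 2 : ℕ) : ℝ) = (√(w k : ℝ) * a k) ^ 2 := fun k => by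
    rw [mul_pow, Real.sq_sqrt (Nat.cast_nonneg _)]; push_cast; ring
  have hge : ∀ k, minRoot w ≤ √(w k : ℝ) * a k := fun k => by
    have h1 : (1 : ℝ) ≤ a k := by exact_mod_cast ha k
    exact (minRoot_le w k).trans (le_mul_of_one_le_right (Real.sqrt_nonneg _) h1)
  have hle : w i * a i ^ 2 ≤ w j * a j ^ 2 := by
    have : ((w i * a i ^ 2 : ℕ) : ℝ) ≤ ((w j * a j ^ 2 : ℕ) : ℝ) := by
      rw [hsq, hsq]
      exact pow_le_pow_left₀ (by positivity) hij 2
    exact_mod_cast this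
  obtain ⟨d, hd⟩ := Nat.exists_eq_add_of_le hle
  have hDd : 2 * minRoot w * D ≤ d := by
    have h1 : (d : ℝ) = D * (√(w j : ℝ) * a j + √(w i : ℝ) * a i) := by
      have := congrArg (Nat.cast (R := ℝ)) hd
      rw [Nat.cast_add, hsq, hsq] at this
      rw [hD]; linear_combination -this
    rw [h1]
    have hD0 : 0 ≤ D := sub_nonneg.2 hij
    nlinarith [hge i, hge j]
  have hexp : Real.exp (rate w * D) ≤ (3 / 2) ^ d := by
    rw [← Real.exp_log (show (0 : ℝ) < (3 / 2) ^ d by positivity), Real.log_pow]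
    refine Real.exp_le_exp.2 ?_
    have := mul_le_mul_of_nonneg_right hDd (Real.log_nonneg (by norm_num : (1 : ℝ) ≤ 3 / 2))
    rw [rate]; linarith
  have hratio : α ^ (w i * a i ^ 2) / α ^ (w j * a j ^ 2) = 1 / α ^ d := by
    rw [hd, pow_add]; field_simp
  rw [hratio]
  cases d with
  | zero =>
    simp only [pow_zero] at hexp ⊢
    have : 0 ≤ 5 / 8 / α := by positivity
    linarith
  | succ k =>
    have h2 : (2 : ℝ) ^ k ≤ α ^ k := pow_le_pow_left₀ (by norm_num) hα k
    rw [mul_one_div, div_le_div_iff₀ (by positivity) hα0]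
    have h3 : Real.exp (rate w * D) - 1 ≤ 5 / 8 * α ^ k := by
      linarith [three_halves_pow_le k]
    calc _ ≤ 5 / 8 * α ^ k * α := mul_le_mul_of_nonneg_right h3 hα0.le
      _ = _ := by ring

/-- The condition on `α` forces `α > 2` as soon as there are two sources. -/
theorem two_le_of_lt {N : ℕ} (hN : 2 ≤ N) {w : Fin N → ℕ} (hw : ∀ i, 0 < w i) {α : ℝ}
    (hαw : ((N : ℝ) - 1) * (∑ i, √(w i : ℝ)) / minRoot w < α) : 2 ≤ α := by
  have hm := minRoot_pos (by omega) hw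
  have hN' : (2 : ℝ) ≤ N := by exact_mod_cast hN
  have hS : (N : ℝ) * minRoot w ≤ ∑ i, √(w i : ℝ) := by
    calc (N : ℝ) * minRoot w = ∑ _i : Fin N, minRoot w := by simp
      _ ≤ _ := Finset.sum_le_sum fun i _ => minRoot_le w i
  refine le_trans ?_ hαw.le
  rw [le_div_iff₀ hm]
  calc 2 * minRoot w ≤ N * minRoot w := by gcongr
    _ ≤ 1 * ∑ i, √(w i : ℝ) := by rw [one_mul]; exact hS
    _ ≤ _ := mul_le_mul_of_nonneg_right (by linarith)
        (Finset.sum_nonneg fun _ _ => Real.sqrt_nonneg _)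

/-- The exponential moment of the shortfall of Fresh-CSMA relative to serving the source with the
largest `√wᵢ aᵢ`. -/
theorem lintegral_exp_shortfall_le {N : ℕ} (hN : 1 ≤ N) {w : Fin N → ℕ} (hw : ∀ i, 0 < w i) {α : ℝ}
    (hα : 0 < α) (hαw : ((N : ℝ) - 1) * (∑ i, √(w i : ℝ)) / minRoot w < α)
    {a : Fin N → ℕ} (ha : ∀ i, 1 ≤ a i) :
    ∫⁻ u, ENNReal.ofReal (Real.exp (rate w * (peak w a - gain w a u)))
        ∂(timerLaw w α a).map firstTimers ≤
      ENNReal.ofReal (Real.exp (((N : ℝ) - 1) * (5 / 8 / α))) := by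
  have : Nonempty (Fin N) := ⟨⟨0, hN⟩⟩
  have := isProbabilityMeasure_timerLaw w hα a
  obtain ⟨j, hj⟩ := exists_eq_ciSup_of_finite (f := fun i => √(w i : ℝ) * (a i : ℝ))
  have hj : √(w j : ℝ) * (a j : ℝ) = peak w a := hj
  have hmax : ∀ i, √(w i : ℝ) * a i ≤ √(w j : ℝ) * a j := fun i => hj ▸ le_peak w a i
  set e : Fin N → ℝ := fun i => Real.exp (rate w * (peak w a - √(w i : ℝ) * a i)) - 1 with he
  have he0 : ∀ i, 0 ≤ e i := fun i => by
    have := mul_nonneg (rate_pos hN hw).le (sub_nonneg.2 (le_peak w a i))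
    have := Real.one_le_exp this
    simp only [he]; linarith
  let B : Fin N → Set (Fin N → ℝ) := fun i => {z | z i ≤ z j}
  have hB : ∀ i, MeasurableSet (B i) := fun i =>
    measurableSet_le (measurable_pi_apply i) (measurable_pi_apply j)
  rw [lintegral_map (measurable_of_countable _) measurable_firstTimers]
  calc _ ≤ ∫⁻ z, 1 + ∑ i ∈ Finset.univ.erase j, (B i).indicator (fun _ => ENNReal.ofReal (e i)) z
          ∂timerLaw w α a := by
        refine lintegral_mono_ae ?_
        filter_upwards [ae_firstTimers_eq_singleton hN w hα a] with z ⟨i, hi⟩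
        rw [hi, gain_singleton]
        by_cases hij : i = j
        · subst hij
          simp [hj]
        · have hzi : z ∈ B i := by
            have : i ∈ firstTimers z := by simp [hi]
            simp only [firstTimers, Finset.mem_filter] at this
            exact this.2 j
          have h1 : ENNReal.ofReal (Real.exp (rate w * (peak w a - √(w i : ℝ) * a i))) =
              1 + (B i).indicator (fun _ => ENNReal.ofReal (e i)) z := by
            rw [Set.indicator_of_mem hzi, ← ENNReal.ofReal_one,
              ← ENNReal.ofReal_add zero_le_one (he0 i)]
            simp only [he]; congr 1; ring
          rw [h1]
          exact add_le_add le_rfl (Finset.single_le_sum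
            (f := fun i => (B i).indicator (fun _ => ENNReal.ofReal (e i)) z)
            (fun _ _ => zero_le) (by simp [hij]))
    _ = 1 + ∑ i ∈ Finset.univ.erase j, ENNReal.ofReal (e i) * timerLaw w α a (B i) := by
        rw [lintegral_add_left measurable_const,
          lintegral_finsetSum _ fun i _ => measurable_const.indicator (hB i)]
        simp [hB]
    _ ≤ 1 + ∑ i ∈ Finset.univ.erase j, ENNReal.ofReal (5 / 8 / α) := by
        gcongr with i hi
        have hij : i ≠ j := Finset.ne_of_mem_erase hi
        have h2 : 2 ≤ N := by
          have := Fin.val_ne_of_ne hij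
          omega
        calc _ ≤ ENNReal.ofReal (e i) *
              ENNReal.ofReal (α ^ (w i * a i ^ 2) / α ^ (w j * a j ^ 2)) := by
              gcongr
              exact timerLaw_le w hα a hij
          _ = ENNReal.ofReal (e i * (α ^ (w i * a i ^ 2) / α ^ (w j * a j ^ 2))) :=
              (ENNReal.ofReal_mul (he0 i)).symm
          _ ≤ _ := by
              refine ENNReal.ofReal_le_ofReal ?_
              simp only [he, ← hj]
              exact exp_shortfall_mul_le (two_le_of_lt h2 hw hαw) ha (hmax i)
    _ = ENNReal.ofReal (1 + ((N : ℝ) - 1) * (5 / 8 / α)) := by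
        have h1 : (0 : ℝ) ≤ (N : ℝ) - 1 := by
          have : (1 : ℝ) ≤ N := by exact_mod_cast hN
          linarith
        rw [ENNReal.ofReal_add zero_le_one (by positivity), ENNReal.ofReal_mul h1,
          Finset.sum_const, Finset.card_erase_of_mem (Finset.mem_univ j), Finset.card_univ,
          Fintype.card_fin, nsmul_eq_mul, ← ENNReal.ofReal_natCast, Nat.cast_sub hN]
        simp
    _ ≤ _ := ENNReal.ofReal_le_ofReal (by
        linarith [Real.add_one_le_exp (((N : ℝ) - 1) * (5 / 8 / α))])

/-! ### Exponential moments along the trajectory -/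

/-- The Lyapunov function plus the accumulated peaks, `∑ₖ peak (age k) + potential (age t)`, as a
function of the first `t` slots. It is given by its increments, which are `∑ √wᵢ` plus the
shortfall of the slot. -/
noncomputable def cumulative {N : ℕ} (w a₀ : Fin N → ℕ) : (t : ℕ) → (Fin t → Finset (Fin N)) → ℝ
  | 0, _ => potential w a₀
  | t + 1, h => cumulative w a₀ t (Fin.init h) + ∑ i, √(w i : ℝ) +
      (peak w (ageAfter a₀ t (Fin.init h)) - gain w (ageAfter a₀ t (Fin.init h)) (h (Fin.last t)))

theorem cumulative_succ {N : ℕ} (w a₀ : Fin N → ℕ) (s : ℕ → Finset (Fin N)) (t : ℕ) :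
    cumulative w a₀ (t + 1) (fun k => s k) = cumulative w a₀ t (fun k => s k) + ∑ i, √(w i : ℝ) +
      (peak w (ageAfter a₀ t fun k => s k) - gain w (ageAfter a₀ t fun k => s k) (s t)) := rfl

theorem cumulative_eq {N : ℕ} (w a₀ : Fin N → ℕ) (s : ℕ → Finset (Fin N)) (T : ℕ) :
    cumulative w a₀ T (fun k => s k) =
      ∑ t ∈ Finset.range T, peak w (age a₀ s t) + potential w (age a₀ s T) := by
  induction T with
  | zero =>
    simp only [Finset.range_zero, Finset.sum_empty, zero_add]
    rfl
  | succ T ih =>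
    rw [cumulative_succ, ih, Finset.sum_range_succ, age_succ, potential_ageStep]
    change _ + _ + (peak w (age a₀ s T) - gain w (age a₀ s T) (s T)) = _
    ring

/-- The peaks dominate `√wᵢ` times the age of every source `i`, which turns a bound on the cumulative
process into one on each average age. -/
theorem sum_age_le_cumulative {N : ℕ} (w a₀ : Fin N → ℕ) (s : ℕ → Finset (Fin N)) (T : ℕ)
    (i : Fin N) :
    √(w i : ℝ) * ∑ t ∈ Finset.range T, (age a₀ s t i : ℝ) ≤ cumulative w a₀ T fun k => s k := by
  rw [cumulative_eq, Finset.mul_sum]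
  have := Finset.sum_le_sum fun t (_ : t ∈ Finset.range T) => le_peak w (age a₀ s t) i
  linarith [potential_nonneg w (age a₀ s T)]

theorem cumulative_nonneg {N : ℕ} (w a₀ : Fin N → ℕ) (hN : 1 ≤ N) (s : ℕ → Finset (Fin N)) (T : ℕ) :
    0 ≤ cumulative w a₀ T fun k => s k :=
  le_trans (by positivity) (sum_age_le_cumulative w a₀ s T ⟨0, hN⟩)

theorem measurable_comp_history {N : ℕ} {β : Type*} [MeasurableSpace β] (T : ℕ)
    (f : (Fin T → Finset (Fin N)) → β) :
    Measurable fun s : ℕ → Finset (Fin N) => f fun k => s k :=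
  (measurable_of_countable f).comp (measurable_pi_lambda _ fun _ => measurable_pi_apply _)

/-- The exponential supermartingale estimate: each slot multiplies the exponential moment by at most
`exp (rate * ∑ √wᵢ)` times the moment of the shortfall. -/
theorem lintegral_exp_cumulative_le {N : ℕ} (hN : 1 ≤ N) {w : Fin N → ℕ} (hw : ∀ i, 0 < w i)
    {a₀ : Fin N → ℕ} (ha₀ : ∀ i, 1 ≤ a₀ i) {α : ℝ} (hα : 0 < α)
    (hαw : ((N : ℝ) - 1) * (∑ i, √(w i : ℝ)) / minRoot w < α) (T : ℕ) :
    ∫⁻ s, ENNReal.ofReal (Real.exp (rate w * cumulative w a₀ T fun k => s k))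
        ∂(freshCSMA w α hα a₀).law ≤
      ENNReal.ofReal (Real.exp (rate w * potential w a₀ +
        T * (rate w * ∑ i, √(w i : ℝ) + ((N : ℝ) - 1) * (5 / 8 / α)))) := by
  set S := ∑ i, √(w i : ℝ) with hS
  set c := ((N : ℝ) - 1) * (5 / 8 / α) with hc
  induction T with
  | zero => simp [cumulative]
  | succ T ih =>
    have hsplit : ∀ s : ℕ → Finset (Fin N),
        ENNReal.ofReal (Real.exp (rate w * cumulative w a₀ (T + 1) fun k => s k)) =
        ENNReal.ofReal (Real.exp (rate w * S)) *
          ENNReal.ofReal (Real.exp (rate w * cumulative w a₀ T fun k => s k)) *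
        ENNReal.ofReal (Real.exp (rate w * (peak w (ageAfter a₀ T fun k => s k) -
          gain w (ageAfter a₀ T fun k => s k) (s T)))) := fun s => by
      rw [← ENNReal.ofReal_mul (Real.exp_nonneg _), ← ENNReal.ofReal_mul (by positivity),
        ← Real.exp_add, ← Real.exp_add, cumulative_succ]
      congr 2
      ring
    simp only [hsplit]
    rw [lintegral_law_eq (freshCSMA w α hα a₀) T fun h u =>
      ENNReal.ofReal (Real.exp (rate w * S)) *
          ENNReal.ofReal (Real.exp (rate w * cumulative w a₀ T h)) *
        ENNReal.ofReal (Real.exp (rate w * (peak w (ageAfter a₀ T h) -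
          gain w (ageAfter a₀ T h) u)))]
    calc _ ≤ ∫⁻ s, ENNReal.ofReal (Real.exp (rate w * S)) *
            ENNReal.ofReal (Real.exp (rate w * cumulative w a₀ T fun k => s k)) *
            ENNReal.ofReal (Real.exp c) ∂(freshCSMA w α hα a₀).law := by
          refine lintegral_mono fun s => ?_
          rw [lintegral_const_mul _ (measurable_of_countable _)]
          gcongr
          exact lintegral_exp_shortfall_le hN hw hα hαw (one_le_ageAfter ha₀ T _)
      _ = ENNReal.ofReal (Real.exp (rate w * S)) *
            (∫⁻ s, ENNReal.ofReal (Real.exp (rate w * cumulative w a₀ T fun k => s k))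
              ∂(freshCSMA w α hα a₀).law) * ENNReal.ofReal (Real.exp c) := by
          have hm := measurable_comp_history (N := N) T fun h =>
            ENNReal.ofReal (Real.exp (rate w * cumulative w a₀ T h))
          rw [lintegral_mul_const _ (hm.const_mul _), lintegral_const_mul _ hm]
      _ ≤ _ := mul_le_mul' (mul_le_mul' le_rfl ih) le_rfl
      _ = _ := by
          rw [← ENNReal.ofReal_mul (Real.exp_nonneg _), ← ENNReal.ofReal_mul (by positivity),
            ← Real.exp_add, ← Real.exp_add]
          congr 2
          push_cast
          ring

theorem sum_sqrt_pos {N : ℕ} (hN : 1 ≤ N) {w : Fin N → ℕ} (hw : ∀ i, 0 < w i) :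
    0 < ∑ i, √(w i : ℝ) :=
  have : Nonempty (Fin N) := ⟨⟨0, hN⟩⟩
  Finset.sum_pos (fun i _ => Real.sqrt_pos.2 (by exact_mod_cast hw i)) Finset.univ_nonempty

/-- The mean loss per slot is small enough to be absorbed by the term `∑ wᵢ` of the lower bound. -/
theorem loss_lt {N : ℕ} (hN : 1 ≤ N) {w : Fin N → ℕ} (hw : ∀ i, 0 < w i) {α : ℝ} (hα : 0 < α)
    (hαw : ((N : ℝ) - 1) * (∑ i, √(w i : ℝ)) / minRoot w < α) :
    rate w * ∑ i, √(w i : ℝ) + ((N : ℝ) - 1) * (5 / 8 / α) <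
      rate w * (∑ i, √(w i : ℝ) + 1 / ∑ i, √(w i : ℝ)) := by
  have hm := minRoot_pos hN hw
  have hS := sum_sqrt_pos hN hw
  set S := ∑ i, √(w i : ℝ)
  rw [div_lt_iff₀ hm] at hαw
  -- `5 / 8 < 2 * log (3 / 2)` leaves the room that is needed
  have hlog : 1 / 3 ≤ Real.log (3 / 2) := by
    have := Real.one_sub_inv_le_log_of_pos (show (0 : ℝ) < 3 / 2 by norm_num)
    norm_num at this ⊢
    linarith
  have h1 : ((N : ℝ) - 1) * (5 / 8 / α) < rate w * (1 / S) := by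
    rw [mul_one_div, mul_div_assoc', div_lt_div_iff₀ hα hS, rate]
    have h2 := mul_le_mul_of_nonneg_left hlog (by positivity : 0 ≤ 2 * minRoot w * α)
    nlinarith [mul_pos hα hm]
  linarith

/-- Average ages at most `(S + 1 / S) / √wᵢ`, where `S = ∑ √wᵢ`, give a weighted sum at most
`S ^ 2 + 1`, hence at most twice the universal lower bound `(S ^ 2 + ∑ wᵢ) / 2`. -/
theorem sum_weighted_le {N : ℕ} (hN : 1 ≤ N) {w : Fin N → ℕ} (hw : ∀ i, 0 < w i)
    {x : Fin N → ℝ≥0∞}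
    (hx : ∀ i, x i ≤
      ENNReal.ofReal ((∑ i, √(w i : ℝ) + 1 / ∑ i, √(w i : ℝ)) / √(w i : ℝ))) :
    ∑ i, (w i : ℝ≥0∞) * x i ≤
      2 * ENNReal.ofReal (((∑ i, √(w i : ℝ)) ^ 2 + ∑ i, (w i : ℝ)) / 2) := by
  have hS := sum_sqrt_pos hN hw
  set S := ∑ i, √(w i : ℝ) with hSdef
  have hW : (1 : ℝ) ≤ ∑ i, (w i : ℝ) := by
    calc (1 : ℝ) ≤ w ⟨0, hN⟩ := by exact_mod_cast hw _
      _ ≤ _ := Finset.single_le_sum (f := fun i => (w i : ℝ)) (fun _ _ => Nat.cast_nonneg _)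
          (Finset.mem_univ _)
  calc _ ≤ ∑ i, ENNReal.ofReal (√(w i : ℝ) * (S + 1 / S)) := by
        refine Finset.sum_le_sum fun i _ => ?_
        refine (mul_le_mul' le_rfl (hx i)).trans (le_of_eq ?_)
        have hi : 0 < √(w i : ℝ) := Real.sqrt_pos.2 (by exact_mod_cast hw i)
        rw [← ENNReal.ofReal_natCast, ← ENNReal.ofReal_mul (Nat.cast_nonneg _)]
        congr 1
        nth_rw 1 [← Real.mul_self_sqrt (Nat.cast_nonneg (w i))]
        field_simp
    _ = ENNReal.ofReal (S * (S + 1 / S)) := by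
        rw [← ENNReal.ofReal_sum_of_nonneg fun i _ => by positivity, ← Finset.sum_mul]
    _ ≤ _ := by
        rw [← ENNReal.ofReal_ofNat, ← ENNReal.ofReal_mul (by norm_num)]
        refine ENNReal.ofReal_le_ofReal ?_
        have : S * (S + 1 / S) = S ^ 2 + 1 := by field_simp
        rw [this]; linarith

theorem sum_age_le_of_cumulative_le {N : ℕ} {w : Fin N → ℕ} (hw : ∀ i, 0 < w i)
    (a₀ : Fin N → ℕ) (s : ℕ → Finset (Fin N)) (T : ℕ) (i : Fin N) :
    ∑ t ∈ Finset.range T, (age a₀ s t i : ℝ≥0∞) ≤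
      ENNReal.ofReal (1 / √(w i : ℝ)) * ENNReal.ofReal (cumulative w a₀ T fun k => s k) := by
  have hi : 0 < √(w i : ℝ) := Real.sqrt_pos.2 (by exact_mod_cast hw i)
  have h := sum_age_le_cumulative w a₀ s T i
  rw [← ENNReal.ofReal_mul (by positivity), one_div_mul_eq_div]
  calc _ = ENNReal.ofReal (∑ t ∈ Finset.range T, (age a₀ s t i : ℝ)) := by
        rw [ENNReal.ofReal_sum_of_nonneg fun _ _ => Nat.cast_nonneg _]
        simp
    _ ≤ _ := ENNReal.ofReal_le_ofReal (by rw [le_div_iff₀ hi]; linarith)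

/-! ### Average ages under Fresh-CSMA -/

section FreshCSMABounds

variable {N : ℕ} {w a₀ : Fin N → ℕ} {α : ℝ}

/-- The exponential moments decay geometrically once the process is centred at the slope
`S + 1 / S`, which by `loss_lt` exceeds the rate at which they can grow. -/
theorem lintegral_exp_normalized_le (hN : 1 ≤ N) (hw : ∀ i, 0 < w i) (ha₀ : ∀ i, 1 ≤ a₀ i)
    (hα : 0 < α) (hαw : ((N : ℝ) - 1) * (∑ i, √(w i : ℝ)) / minRoot w < α) :
    ∃ η : ℝ, 0 < η ∧ ∀ T : ℕ,
    ∫⁻ s, ENNReal.ofReal (Real.exp (rate w * ((cumulative w a₀ T fun k => s k) -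
      (potential w a₀ + T * (∑ i, √(w i : ℝ) + 1 / ∑ i, √(w i : ℝ))))))
        ∂(freshCSMA w α hα a₀).law ≤ ENNReal.ofReal (Real.exp (-η)) ^ T := by
  have hloss := loss_lt hN hw hα hαw
  set S := ∑ i, √(w i : ℝ) with hS
  set c := ((N : ℝ) - 1) * (5 / 8 / α) with hc
  refine ⟨rate w * (S + 1 / S) - (rate w * S + c), sub_pos.2 hloss, fun T => ?_⟩
  set B := potential w a₀ + T * (S + 1 / S) with hB
  have hm := measurable_comp_history (N := N) T fun h =>
    ENNReal.ofReal (Real.exp (rate w * cumulative w a₀ T h))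
  calc _ = ∫⁻ s, ENNReal.ofReal (Real.exp (-(rate w * B))) *
        ENNReal.ofReal (Real.exp (rate w * cumulative w a₀ T fun k => s k))
        ∂(freshCSMA w α hα a₀).law := by
        refine lintegral_congr fun s => ?_
        rw [← ENNReal.ofReal_mul (Real.exp_nonneg _), ← Real.exp_add]
        congr 2
        ring
    _ ≤ ENNReal.ofReal (Real.exp (-(rate w * B))) * ENNReal.ofReal (Real.exp
        (rate w * potential w a₀ + T * (rate w * S + c))) := by
        rw [lintegral_const_mul _ hm]
        exact mul_le_mul' le_rfl (lintegral_exp_cumulative_le hN hw ha₀ hα hαw T)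
    _ = _ := by
        rw [← ENNReal.ofReal_mul (Real.exp_nonneg _), ← Real.exp_add,
          ← ENNReal.ofReal_pow (Real.exp_nonneg _), ← Real.exp_nat_mul]
        congr 2
        rw [hB]
        ring

theorem lintegral_cumulative_le (hN : 1 ≤ N) (hw : ∀ i, 0 < w i) (ha₀ : ∀ i, 1 ≤ a₀ i)
    (hα : 0 < α) (hαw : ((N : ℝ) - 1) * (∑ i, √(w i : ℝ)) / minRoot w < α) (T : ℕ) :
    ∫⁻ s, ENNReal.ofReal (cumulative w a₀ T fun k => s k) ∂(freshCSMA w α hα a₀).law ≤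
      ENNReal.ofReal (potential w a₀ + T * (∑ i, √(w i : ℝ) + 1 / ∑ i, √(w i : ℝ))) := by
  obtain ⟨η, hη, h⟩ := lintegral_exp_normalized_le hN hw ha₀ hα hαw
  have hS := sum_sqrt_pos hN hw
  have hr := rate_pos hN hw
  set B := potential w a₀ + T * (∑ i, √(w i : ℝ) + 1 / ∑ i, √(w i : ℝ)) with hB
  have hB0 : 0 ≤ B := by
    have := potential_nonneg w a₀
    positivity
  have hm := measurable_comp_history (N := N) T fun h =>
    ENNReal.ofReal (cumulative w a₀ T h)
  have h1 : ENNReal.ofReal (Real.exp (-η)) ^ T ≤ 1 :=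
    pow_le_one₀ zero_le (by
      rw [← ENNReal.ofReal_one]
      exact ENNReal.ofReal_le_ofReal (Real.exp_le_one_iff.2 (by linarith)))
  -- Jensen's inequality, in the form `1 + y ≤ exp y`
  have h2 : ENNReal.ofReal (rate w) *
      (∫⁻ s, ENNReal.ofReal (cumulative w a₀ T fun k => s k) ∂(freshCSMA w α hα a₀).law) + 1 ≤
      ENNReal.ofReal (rate w) * ENNReal.ofReal B + 1 := by
    calc _ = ∫⁻ s, ENNReal.ofReal (rate w) * ENNReal.ofReal (cumulative w a₀ T fun k => s k) + 1
          ∂(freshCSMA w α hα a₀).law := by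
          rw [lintegral_add_right _ measurable_const, lintegral_const_mul _ hm]; simp
      _ ≤ ∫⁻ s, ENNReal.ofReal (rate w) * ENNReal.ofReal B +
          ENNReal.ofReal (Real.exp (rate w * ((cumulative w a₀ T fun k => s k) - B)))
          ∂(freshCSMA w α hα a₀).law := by
          refine lintegral_mono fun s => ?_
          have hc := cumulative_nonneg w a₀ hN s T
          simp only
          rw [← ENNReal.ofReal_mul hr.le, ← ENNReal.ofReal_mul hr.le, ← ENNReal.ofReal_one,
            ← ENNReal.ofReal_add (by positivity) zero_le_one,
            ← ENNReal.ofReal_add (by positivity) (Real.exp_nonneg _)]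
          refine ENNReal.ofReal_le_ofReal ?_
          linarith [Real.add_one_le_exp (rate w * ((cumulative w a₀ T fun k => s k) - B))]
      _ ≤ _ := by
          rw [lintegral_add_left measurable_const]
          simp only [lintegral_const, measure_univ, mul_one]
          exact add_le_add le_rfl ((h T).trans h1)
  have h3 := (ENNReal.add_le_add_iff_right ENNReal.one_ne_top).1 h2
  exact (ENNReal.mul_le_mul_iff_right (ENNReal.ofReal_pos.2 hr).ne' ENNReal.ofReal_ne_top).1 h3

theorem ofReal_one_div_mul_affine {r p U : ℝ} (hr : 0 < r) (hp : 0 ≤ p) (hU : 0 ≤ U) (T : ℕ) :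
    ENNReal.ofReal (1 / r) * ENNReal.ofReal (p + T * U) =
      ENNReal.ofReal (U / r) * T + ENNReal.ofReal (p / r) := by
  rw [← ENNReal.ofReal_mul (by positivity), ← ENNReal.ofReal_natCast,
    ← ENNReal.ofReal_mul (by positivity), ← ENNReal.ofReal_add (by positivity) (by positivity)]
  congr 1
  field_simp
  ring

theorem avgAoI_freshCSMA_le (hN : 1 ≤ N) (hw : ∀ i, 0 < w i) (ha₀ : ∀ i, 1 ≤ a₀ i)
    (hα : 0 < α) (hαw : ((N : ℝ) - 1) * (∑ i, √(w i : ℝ)) / minRoot w < α) (i : Fin N) :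
    avgAoI a₀ (freshCSMA w α hα a₀) i ≤
      ENNReal.ofReal ((∑ i, √(w i : ℝ) + 1 / ∑ i, √(w i : ℝ)) / √(w i : ℝ)) := by
  have hi : 0 < √(w i : ℝ) := Real.sqrt_pos.2 (by exact_mod_cast hw i)
  have hS := sum_sqrt_pos hN hw
  refine timeAvg_le (C := ENNReal.ofReal (potential w a₀ / √(w i : ℝ))) ENNReal.ofReal_ne_top
    (Eventually.of_forall fun T => ?_)
  have hm : ∀ t, Measurable fun s : ℕ → Finset (Fin N) => (age a₀ s t i : ℝ≥0∞) := fun t =>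
    (measurable_of_countable _).comp (measurable_age a₀ t i)
  rw [← lintegral_finsetSum _ fun t _ => hm t,
    ← ofReal_one_div_mul_affine hi (potential_nonneg w a₀) (by positivity)]
  calc _ ≤ ∫⁻ s, ENNReal.ofReal (1 / √(w i : ℝ)) *
        ENNReal.ofReal (cumulative w a₀ T fun k => s k) ∂(freshCSMA w α hα a₀).law :=
        lintegral_mono fun s => sum_age_le_of_cumulative_le hw a₀ s T i
    _ ≤ _ := by
        rw [lintegral_const_mul _ (measurable_comp_history (N := N) T fun h =>
          ENNReal.ofReal (cumulative w a₀ T h))]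
        exact mul_le_mul' le_rfl (lintegral_cumulative_le hN hw ha₀ hα hαw T)

/-- Markov's inequality for the exponential moments, followed by the Borel–Cantelli lemma. -/
theorem ae_eventually_cumulative_le (hN : 1 ≤ N) (hw : ∀ i, 0 < w i) (ha₀ : ∀ i, 1 ≤ a₀ i)
    (hα : 0 < α) (hαw : ((N : ℝ) - 1) * (∑ i, √(w i : ℝ)) / minRoot w < α) :
    ∀ᵐ s ∂(freshCSMA w α hα a₀).law, ∀ᶠ T : ℕ in atTop, (cumulative w a₀ T fun k => s k) ≤
      potential w a₀ + T * (∑ i, √(w i : ℝ) + 1 / ∑ i, √(w i : ℝ)) := by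
  obtain ⟨η, hη, h⟩ := lintegral_exp_normalized_le hN hw ha₀ hα hαw
  have hr := rate_pos hN hw
  set B : ℕ → ℝ := fun T => potential w a₀ + T * (∑ i, √(w i : ℝ) + 1 / ∑ i, √(w i : ℝ)) with hB
  let bad : ℕ → Set (ℕ → Finset (Fin N)) := fun T =>
    {s | 1 ≤ ENNReal.ofReal (Real.exp (rate w * ((cumulative w a₀ T fun k => s k) - B T)))}
  have hbad : ∀ T, (freshCSMA w α hα a₀).law (bad T) ≤ ENNReal.ofReal (Real.exp (-η)) ^ T :=
    fun T => by
    have := mul_meas_ge_le_lintegral (μ := (freshCSMA w α hα a₀).law)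
      (measurable_comp_history (N := N) T fun h =>
        ENNReal.ofReal (Real.exp (rate w * (cumulative w a₀ T h - B T)))) 1
    rw [one_mul] at this
    exact this.trans (h T)
  have hsum : ∑' T, (freshCSMA w α hα a₀).law (bad T) ≠ ∞ := by
    refine ne_top_of_le_ne_top ?_ (ENNReal.tsum_le_tsum hbad)
    rw [ENNReal.tsum_geometric, ENNReal.inv_ne_top]
    refine (tsub_pos_of_lt ?_).ne'
    rw [← ENNReal.ofReal_one]
    exact (ENNReal.ofReal_lt_ofReal_iff one_pos).2 (Real.exp_lt_one_iff.2 (by linarith))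
  filter_upwards [ae_eventually_notMem hsum] with s hs
  filter_upwards [hs] with T hT
  by_contra hlt
  refine hT ?_
  change 1 ≤ ENNReal.ofReal _
  rw [← ENNReal.ofReal_one]
  refine ENNReal.ofReal_le_ofReal (Real.one_le_exp ?_)
  have : B T < cumulative w a₀ T fun k => s k := not_le.1 hlt
  exact mul_nonneg hr.le (sub_nonneg.2 this.le)

theorem ae_pathAvgAoI_freshCSMA_le (hN : 1 ≤ N) (hw : ∀ i, 0 < w i) (ha₀ : ∀ i, 1 ≤ a₀ i)
    (hα : 0 < α) (hαw : ((N : ℝ) - 1) * (∑ i, √(w i : ℝ)) / minRoot w < α) :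
    ∀ᵐ s ∂(freshCSMA w α hα a₀).law, ∀ i, pathAvgAoI a₀ s i ≤
      ENNReal.ofReal ((∑ i, √(w i : ℝ) + 1 / ∑ i, √(w i : ℝ)) / √(w i : ℝ)) := by
  have hS := sum_sqrt_pos hN hw
  filter_upwards [ae_eventually_cumulative_le hN hw ha₀ hα hαw] with s hs i
  have hi : 0 < √(w i : ℝ) := Real.sqrt_pos.2 (by exact_mod_cast hw i)
  refine timeAvg_le (C := ENNReal.ofReal (potential w a₀ / √(w i : ℝ))) ENNReal.ofReal_ne_top ?_
  filter_upwards [hs] with T hT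
  rw [← ofReal_one_div_mul_affine hi (potential_nonneg w a₀) (by positivity)]
  exact (sum_age_le_of_cumulative_le hw a₀ s T i).trans
    (mul_le_mul' le_rfl (ENNReal.ofReal_le_ofReal hT))

end FreshCSMABounds

end FreshCSMA

theorem theorem2 {N : ℕ} (hN : 1 ≤ N)
    (w : Fin N → ℕ) (hw : ∀ i, 0 < w i)
    (a₀ : Fin N → ℕ) (ha₀ : ∀ i, 1 ≤ a₀ i)
    (α : ℝ) (hα : 0 < α)
    (hαw : ((N : ℝ) - 1) * (∑ i, √(w i : ℝ)) / (⨅ j, √(w j : ℝ)) < α) :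
    -- the ratio bound against any optimal policy
    (∀ πopt : FreshCSMA.Policy N, FreshCSMA.IsOptimal w a₀ πopt →
      (∑ i, (w i : ℝ≥0∞) * FreshCSMA.avgAoI a₀ (FreshCSMA.freshCSMA w α hα a₀) i) /
        (∑ i, (w i : ℝ≥0∞) * FreshCSMA.avgAoI a₀ πopt i) ≤ 2) ∧
    -- the bound against the optimal value, whether or not it is attained
    (∑ i, (w i : ℝ≥0∞) * FreshCSMA.avgAoI a₀ (FreshCSMA.freshCSMA w α hα a₀) i
      ≤ 2 * ⨅ π : FreshCSMA.Policy N, FreshCSMA.cost w a₀ π) ∧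
    -- the same for time averages along sample paths, almost surely
    (∀ π : FreshCSMA.Policy N,
      ∀ᵐ s ∂(FreshCSMA.freshCSMA w α hα a₀).law, ∀ᵐ s' ∂π.law,
        ∑ i, (w i : ℝ≥0∞) * FreshCSMA.pathAvgAoI a₀ s i
          ≤ 2 * FreshCSMA.pathCost w a₀ s') := by
  have hmean := FreshCSMA.sum_weighted_le hN hw
    (FreshCSMA.avgAoI_freshCSMA_le hN hw ha₀ hα hαw)
  refine ⟨fun πopt _ => ENNReal.div_le_of_le_mul ?_, ?_, fun π => ?_⟩
  · exact hmean.trans (mul_le_mul' le_rfl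
      ((FreshCSMA.le_cost w hw a₀ πopt).trans (FreshCSMA.cost_le_sum_avgAoI w a₀ πopt)))
  · exact hmean.trans (mul_le_mul' le_rfl (le_iInf (FreshCSMA.le_cost w hw a₀)))
  · filter_upwards [FreshCSMA.ae_pathAvgAoI_freshCSMA_le hN hw ha₀ hα hαw] with s hs
    exact Eventually.of_forall fun s' => (FreshCSMA.sum_weighted_le hN hw hs).trans
      (mul_le_mul' le_rfl (FreshCSMA.le_pathCost w hw a₀ s'))
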